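/- A \emph{contact algebra} $(B,C)$ is a Boolean algebra $B$ ($0=1$ is allowed) with a binary relation $C$ on $B$ such that for all $a,b,c\in B$: $a\ne 0$ implies $aCa$; $aCb$ implies $a\neq 0$ and $b\ne 0$; $aCb$ implies $bCa$; and $aC(b\vee c)$ if and only if $aCb$ or $aCc$. Write $a\ll_C b$ if $a$ and the complement $b^*$ are not in the relation $C$. A \emph{complete local contact algebra} $(B,\rho,\mathbb{B})$ is a complete Boolean algebra $B$ with a contact relation $\rho$ on $B$ and a (possibly non-proper) ideal $\mathbb{B}$ of $B$ such that (BC1) if $a\in\mathbb{B}$, $c\in B$ and $a\ll_\rho c$, then $a\ll_\rho b\ll_\rho c$ for some $b\in\mathbb{B}$; (BC2) if $a\,\rho\, b$, then $a\,\rho\,(c\wedge b)$ for some $c\in\mathbb{B}$; (BC3) if $a\neq 0$, then $b\ll_\rho a$ for some $b\in\mathbb{B}\setminus\{0\}$. Let $\mathbf{OpPerLC}$ be the category of all locally compact Hausdorff spaces and all open perfect maps between them (continuous maps, not necessarily onto, that are open and closed and have compact point inverses). Let $\mathbf{DOpPerLC}$ be the category whose objects are all complete local contact algebras and whose morphisms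 $\varphi:(A,\rho,\mathbb{B})\to(B,\eta,\mathbb{B}')$ are all complete Boolean homomorphisms $\varphi:A\to B$ (preserving all joins, all meets and complements) such that, with $\varphi_\Lambda:B\to A$, $\varphi_\Lambda(b)=\bigwedge\{a\in A \mid b\le\varphi(a)\}$, the left adjoint of $\varphi$, (L1) for all $a,b\in A$, $\varphi(a)\,\eta\,\varphi(b)$ implies $a\,\rho\, b$; (L2) $b\in\mathbb{B}'$ implies $\varphi_\Lambda(b)\in\mathbb{B}$; (L3) $a\in\mathbb{B}$ implies $\varphi(a)\in\mathbb{B}'$; (LO) for all $a\in A$ and $b\in\mathbb{B}'$, $\varphi_\Lambda(b)\,\rho\, a$ implies $b\,\eta\,\varphi(a)$. Composition and identities are those of maps. \textbf{Theorem.} The categories $\mathbf{OpPerLC}$ and $\mathbf{DOpPerLC}$ are dually equivalent. -/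

import Mathlib

open CategoryTheory

universe u

namespace LocalContact

/-! ### Locally compact Hausdorff spaces and open perfect maps -/

/-- A perfect map: a continuous closed map all of whose point inverses are compact. -/
structure IsPerfect {X Y : Type*} [TopologicalSpace X] [TopologicalSpace Y]
    (f : X → Y) : Prop where
  continuous : Continuous f
  isClosedMap : IsClosedMap f
  isCompact_fiber : ∀ y : Y, IsCompact (f ⁻¹' {y})

/-- The objects of the category `OpPerLC`: all locally compact Hausdorff spaces. -/
structure OpPerLC : Type (u + 1) where
  carrier : Type u
  [top : TopologicalSpace carrier]
  [t2 : T2Space carrier]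
  [locallyCompact : LocallyCompactSpace carrier]

attribute [instance] OpPerLC.top OpPerLC.t2 OpPerLC.locallyCompact

/-- The morphisms of `OpPerLC`: all open perfect maps (not necessarily onto). -/
@[ext]
structure OpPerLC.Hom (X Y : OpPerLC.{u}) : Type u where
  toFun : X.carrier → Y.carrier
  isPerfect : IsPerfect toFun
  isOpenMap : IsOpenMap toFun

theorem IsPerfect.id (X : Type*) [TopologicalSpace X] : IsPerfect (fun x : X => x) where
  continuous := continuous_id
  isClosedMap := IsClosedMap.id
  isCompact_fiber _ := isCompact_singleton

theorem IsPerfect.comp {X Y Z : Type*} [TopologicalSpace X] [TopologicalSpace Y]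
    [TopologicalSpace Z] {g : Y → Z} {f : X → Y} (hg : IsPerfect g) (hf : IsPerfect f) :
    IsPerfect (fun x => g (f x)) where
  continuous := hg.continuous.comp hf.continuous
  isClosedMap := hg.isClosedMap.comp hf.isClosedMap
  isCompact_fiber z :=
    (isProperMap_iff_isClosedMap_and_compact_fibers.2
      ⟨hf.continuous, hf.isClosedMap, fun {y} => hf.isCompact_fiber y⟩).isCompact_preimage
      (hg.isCompact_fiber z)

instance OpPerLC.category : Category.{u} OpPerLC.{u} where
  Hom X Y := OpPerLC.Hom X Y
  id X := ⟨fun x => x, IsPerfect.id X.carrier, IsOpenMap.id⟩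
  comp f g := ⟨fun x => g.toFun (f.toFun x), g.isPerfect.comp f.isPerfect,
    g.isOpenMap.comp f.isOpenMap⟩

/-! ### Contact algebras and local contact algebras -/

/-- `C` is a contact relation on the Boolean algebra `B` (in which `⊥ = ⊤` is allowed). -/
structure IsContact {B : Type*} [BooleanAlgebra B] (C : B → B → Prop) : Prop where
  refl_of_ne_bot : ∀ a : B, a ≠ ⊥ → C a a
  ne_bot : ∀ a b : B, C a b → a ≠ ⊥ ∧ b ≠ ⊥
  symm : ∀ a b : B, C a b → C b a
  sup_iff : ∀ a b c : B, C a (b ⊔ c) ↔ C a b ∨ C a c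

/-- Non-tangential inclusion `a ≪ b` with respect to `C`: `a` is not in contact with `bᶜ`. -/
def NonTangential {B : Type*} [BooleanAlgebra B] (C : B → B → Prop) (a b : B) : Prop :=
  ¬ C a bᶜ

/-- `(B, ρ, I)` is a local contact algebra; `I` is a possibly non-proper ideal, and its elements
are called bounded. -/
structure IsLocalContact {B : Type*} [BooleanAlgebra B] (ρ : B → B → Prop)
    (I : Order.Ideal B) : Prop extends IsContact ρ where
  bc1 : ∀ a ∈ I, ∀ c : B, NonTangential ρ a c →
    ∃ b ∈ I, NonTangential ρ a b ∧ NonTangential ρ b c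
  bc2 : ∀ a b : B, ρ a b → ∃ c ∈ I, ρ a (c ⊓ b)
  bc3 : ∀ a : B, a ≠ ⊥ → ∃ b ∈ I, b ≠ ⊥ ∧ NonTangential ρ b a

/-- A complete local contact algebra. -/
structure CLCA : Type (u + 1) where
  carrier : Type u
  [algebra : CompleteBooleanAlgebra carrier]
  contact : carrier → carrier → Prop
  bounded : Order.Ideal carrier
  isLocalContact : IsLocalContact contact bounded

attribute [instance] CLCA.algebra

/-- The left adjoint (lower adjoint) of a complete homomorphism `φ : A → B`:
`b ↦ ⋀ {a | b ≤ φ a}`. -/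
def leftAdjoint {A B : Type*} [CompleteLattice A] [CompleteLattice B]
    (φ : CompleteLatticeHom A B) (b : B) : A :=
  sInf {a : A | b ≤ φ a}

theorem leftAdjoint_gc {A B : Type*} [CompleteLattice A] [CompleteLattice B]
    (φ : CompleteLatticeHom A B) : GaloisConnection (leftAdjoint φ) φ := by
  intro b a
  constructor
  · intro h
    refine le_trans ?_ (OrderHomClass.mono φ h)
    rw [leftAdjoint, map_sInf]
    refine le_sInf ?_
    rintro _ ⟨x, hx, rfl⟩
    exact hx
  · intro h
    exact sInf_le h

theorem leftAdjoint_id {A : Type*} [CompleteLattice A] (a : A) :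
    leftAdjoint (CompleteLatticeHom.id A) a = a :=
  (leftAdjoint_gc (CompleteLatticeHom.id A)).l_unique GaloisConnection.id (fun _ => rfl)

theorem leftAdjoint_comp {A B C : Type*} [CompleteLattice A] [CompleteLattice B]
    [CompleteLattice C] (ψ : CompleteLatticeHom B C) (φ : CompleteLatticeHom A B) (c : C) :
    leftAdjoint (ψ.comp φ) c = leftAdjoint φ (leftAdjoint ψ c) :=
  (leftAdjoint_gc (ψ.comp φ)).l_unique ((leftAdjoint_gc ψ).compose (leftAdjoint_gc φ))
    (fun _ => rfl)

/-- The morphisms of `DSkeLC`: complete Boolean homomorphisms (maps preserving all joins and all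
meets, in particular `⊥`, `⊤` and hence complements) that reflect contact and whose left adjoint sends
bounded elements to bounded elements. -/
@[ext]
structure DSkeLCHom (A B : CLCA.{u}) : Type u where
  toHom : CompleteLatticeHom A.carrier B.carrier
  l1 : ∀ a b : A.carrier, B.contact (toHom a) (toHom b) → A.contact a b
  l2 : ∀ b ∈ B.bounded, leftAdjoint toHom b ∈ A.bounded

/-- The morphisms of `DSkePerLC`: the `DSkeLC`-morphisms that preserve boundedness. -/
@[ext]
structure DSkePerLCHom (A B : CLCA.{u}) : Type u extends DSkeLCHom A B where
  l3 : ∀ a ∈ A.bounded, toHom a ∈ B.bounded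

/-- The morphisms of `DOpPerLC`: the `DSkePerLC`-morphisms that satisfy condition (LO). -/
@[ext]
structure DOpPerLCHom (A B : CLCA.{u}) : Type u extends DSkePerLCHom A B where
  lo : ∀ a : A.carrier, ∀ b ∈ B.bounded,
    A.contact (leftAdjoint toHom b) a → B.contact b (toHom a)

/-- The objects of the category `DOpPerLC`: all complete local contact algebras. -/
def DOpPerLC : Type (u + 1) := CLCA.{u}

/-- The identity morphism. -/
def DOpPerLCHom.id (A : CLCA.{u}) : DOpPerLCHom A A where
  toHom := CompleteLatticeHom.id A.carrier
  l1 _ _ h := h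
  l2 b hb := by rw [leftAdjoint_id]; exact hb
  l3 _ h := h
  lo a b _ h := by
    rw [leftAdjoint_id] at h
    exact h

/-- Composition of morphisms: `f` followed by `g`. -/
def DOpPerLCHom.comp {A B C : CLCA.{u}} (f : DOpPerLCHom A B) (g : DOpPerLCHom B C) :
    DOpPerLCHom A C where
  toHom := g.toHom.comp f.toHom
  l1 a b h := f.l1 a b (g.l1 _ _ h)
  l2 c hc := by rw [leftAdjoint_comp]; exact f.l2 _ (g.l2 c hc)
  l3 a ha := g.l3 _ (f.l3 a ha)
  lo a c hc h := by
    rw [leftAdjoint_comp] at h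
    exact g.lo _ c hc (f.lo a _ (g.l2 c hc) h)

instance DOpPerLC.category : Category.{u} DOpPerLC.{u} where
  Hom A B := DOpPerLCHom A B
  id A := DOpPerLCHom.id A
  comp f g := DOpPerLCHom.comp f g

end LocalContact

/-! The equivalence sends a space to its regular open algebra, with contact meaning that closures
meet and bounded meaning compact closure, and sends a map to preimage. `regOpenFunctor` is shown to
be faithful, full and essentially surjective.

Preimage along a continuous open map commutes with closure and interior, hence is a complete
homomorphism; closedness and compact fibres give (L2), (L3) and (LO). Faithfulness holds because
regular open sets separate points.

The rest rests on points: round filters with a bounded member that are prime for `≪`. In a regular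
open algebra they are exactly the families of regular open neighbourhoods of a point
(`exists_eq_nhds_of_isPoint`). A morphism pulls points back to points
(`DOpPerLCHom.isPoint_preimage`), which yields the underlying map; (L3) makes it proper and the left
adjoint makes it open.

For an abstract algebra, the points form a locally compact Hausdorff space. Enough points exist to
detect contact (`exists_isPoint_of_contact`), and completeness makes every regular open set basic
(`regBasic_surjective`), so the algebra is recovered. -/

open TopologicalSpace Set

namespace LocalContact

/-! ### The algebra of regular open sets -/

/-- The regular open sets of a topological space. -/
abbrev RegOpen (X : Type*) [TopologicalSpace X] := Heyting.Regular (Opens X)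

namespace RegOpen

variable {X : Type*} [TopologicalSpace X]

/-- The underlying set of a regular open set. -/
def pts (U : RegOpen X) : Set X := (U.val : Set X)

theorem isOpen (U : RegOpen X) : IsOpen U.pts := U.val.isOpen

/-- The pseudocomplement of an open set is its exterior, so Heyting-regular means `interior (closure
U) = U`. -/
theorem coe_opens_compl (U : Opens X) : ((Uᶜ : Opens X) : Set X) = (closure (U : Set X))ᶜ := by
  apply Set.Subset.antisymm
  · intro x hx hxU
    obtain ⟨y, hy, hyU⟩ := mem_closure_iff.1 hxU _ (Uᶜ : Opens X).isOpen hx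
    have : y ∈ (U ⊓ Uᶜ : Opens X) := ⟨hyU, hy⟩
    rw [inf_compl_self] at this
    exact this
  · let V : Opens X := ⟨(closure (U : Set X))ᶜ, isClosed_closure.isOpen_compl⟩
    change V ≤ Uᶜ
    rw [le_compl_iff_disjoint_right, disjoint_iff_inf_le]
    intro x hx
    exact hx.1 (subset_closure hx.2)

theorem pts_compl (U : RegOpen X) : (Uᶜ).pts = (closure U.pts)ᶜ := coe_opens_compl _

theorem coe_opens_compl_compl (U : Opens X) :
    ((Uᶜᶜ : Opens X) : Set X) = interior (closure (U : Set X)) := by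
  rw [coe_opens_compl, coe_opens_compl, closure_compl, compl_compl]

theorem interior_closure (U : RegOpen X) : interior (closure U.pts) = U.pts := by
  have h : U.valᶜᶜ = U.val := U.prop
  rw [pts, ← coe_opens_compl_compl, h]

/-- The regular open set `interior (closure s)`. -/
def reg (s : Set X) : RegOpen X :=
  ⟨⟨interior (closure s), isOpen_interior⟩, by
    apply SetLike.coe_injective
    rw [coe_opens_compl_compl]
    exact interior_closure_idem⟩

theorem pts_reg (s : Set X) : (reg s).pts = interior (closure s) := rfl

theorem le_iff {U V : RegOpen X} : U ≤ V ↔ U.pts ⊆ V.pts := Iff.rfl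

theorem pts_injective : Function.Injective (pts (X := X)) := fun _ _ h =>
  le_antisymm (le_iff.2 h.subset) (le_iff.2 h.superset)

theorem reg_pts (U : RegOpen X) : reg U.pts = U := pts_injective U.interior_closure

theorem pts_bot : (⊥ : RegOpen X).pts = ∅ := rfl

theorem pts_eq_empty {U : RegOpen X} : U.pts = ∅ ↔ U = ⊥ :=
  ⟨fun h => pts_injective (h.trans pts_bot.symm), fun h => h ▸ pts_bot⟩

theorem nonempty_pts {U : RegOpen X} : U.pts.Nonempty ↔ U ≠ ⊥ := by
  rw [nonempty_iff_ne_empty, Ne, pts_eq_empty]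

theorem subset_reg {s : Set X} (h : IsOpen s) : s ⊆ (reg s).pts :=
  h.subset_interior_closure

theorem closure_pts_reg {s : Set X} (h : IsOpen s) : closure (reg s).pts = closure s :=
  Subset.antisymm (isClosed_closure.closure_subset_iff.2 interior_subset)
    (closure_mono (subset_reg h))

theorem reg_le {s : Set X} {U : RegOpen X} (h : s ⊆ U.pts) : reg s ≤ U := by
  rw [← reg_pts U]
  exact interior_mono (closure_mono h)

theorem closure_compl_pts (U : RegOpen X) : closure (Uᶜ).pts = (U.pts)ᶜ := by
  rw [pts_compl, closure_compl, interior_closure]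

noncomputable instance : CompleteBooleanAlgebra (RegOpen X) :=
  { (inferInstance : BooleanAlgebra (RegOpen X)) with
    sSup := fun S => reg (⋃ U ∈ S, U.pts)
    isLUB_sSup := fun S => by
      have ho : IsOpen (⋃ U ∈ S, U.pts) := isOpen_biUnion fun U _ => U.isOpen
      refine ⟨fun U hU => (subset_biUnion_of_mem (u := pts) hU).trans (subset_reg ho),
        fun V hV => reg_le (iUnion₂_subset fun U hU => hV hU)⟩
    sInf := fun S => (reg (⋃ U ∈ S, (Uᶜ).pts))ᶜ
    isGLB_sInf := fun S => by
      have ho : IsOpen (⋃ U ∈ S, (Uᶜ).pts) := isOpen_biUnion fun U _ => (Uᶜ).isOpen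
      refine ⟨fun U hU => compl_le_of_compl_le
        ((subset_biUnion_of_mem (u := fun U : RegOpen X => (Uᶜ).pts) hU).trans (subset_reg ho)),
        fun V hV => le_compl_of_le_compl
          (reg_le (iUnion₂_subset fun U hU => compl_le_compl (hV hU)))⟩ }

theorem pts_sSup (S : Set (RegOpen X)) : (sSup S).pts = (reg (⋃ U ∈ S, U.pts)).pts := rfl

theorem sup_eq_reg (U V : RegOpen X) : U ⊔ V = reg (U.pts ∪ V.pts) :=
  le_antisymm
    (sup_le (subset_union_left.trans (subset_reg (U.isOpen.union V.isOpen)))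
      (subset_union_right.trans (subset_reg (U.isOpen.union V.isOpen))))
    (reg_le (union_subset (le_iff.1 le_sup_left) (le_iff.1 le_sup_right)))

theorem closure_pts_sup (U V : RegOpen X) :
    closure (U ⊔ V).pts = closure U.pts ∪ closure V.pts := by
  rw [sup_eq_reg, closure_pts_reg (U.isOpen.union V.isOpen), closure_union]

/-- Two regular open sets are in contact if their closures meet. -/
def Contact (U V : RegOpen X) : Prop := (closure U.pts ∩ closure V.pts).Nonempty

theorem nonTangential_iff {U V : RegOpen X} :
    NonTangential Contact U V ↔ closure U.pts ⊆ V.pts := by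
  rw [NonTangential, Contact, closure_compl_pts, not_nonempty_iff_eq_empty,
    ← disjoint_iff_inter_eq_empty, disjoint_compl_right_iff_subset]

theorem isContact : IsContact (Contact (X := X)) where
  refl_of_ne_bot U hU := by
    obtain ⟨x, hx⟩ := nonempty_pts.2 hU
    exact ⟨x, subset_closure hx, subset_closure hx⟩
  ne_bot U V h := by
    obtain ⟨x, hx, hy⟩ := h
    exact ⟨nonempty_pts.1 (closure_nonempty_iff.1 ⟨x, hx⟩),
      nonempty_pts.1 (closure_nonempty_iff.1 ⟨x, hy⟩)⟩
  symm U V h := by rwa [Contact, inter_comm]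
  sup_iff U V W := by
    rw [Contact, closure_pts_sup, inter_union_distrib_left, union_nonempty]; rfl

variable (X) in
/-- The ideal of regular open sets with compact closure. -/
def boundedIdeal : Order.Ideal (RegOpen X) where
  carrier := {U | IsCompact (closure U.pts)}
  lower' := fun _ _ h hU => hU.of_isClosed_subset isClosed_closure (closure_mono h)
  nonempty' := ⟨⊥, by simp [pts_bot]⟩
  directed' := fun U hU V hV => ⟨U ⊔ V, by
    change IsCompact _
    rw [closure_pts_sup]
    exact hU.union hV, le_sup_left, le_sup_right⟩

theorem mem_boundedIdeal {U : RegOpen X} : U ∈ boundedIdeal X ↔ IsCompact (closure U.pts) :=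
  Iff.rfl

variable [T2Space X] [LocallyCompactSpace X]

/-- Regularising an open set leaves its closure unchanged, so the usual interpolation by relatively
compact open sets can be done with regular open ones. All of (BC1)–(BC3) follow. -/
theorem exists_between {K W : Set X} (hK : IsCompact K) (hW : IsOpen W) (h : K ⊆ W) :
    ∃ U ∈ boundedIdeal X, K ⊆ U.pts ∧ closure U.pts ⊆ W := by
  obtain ⟨V, hV, hKV, hVW, hc⟩ := exists_open_between_and_isCompact_closure hK hW h
  refine ⟨reg V, ?_, hKV.trans (subset_reg hV), ?_⟩
  · rwa [mem_boundedIdeal, closure_pts_reg hV]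
  · rwa [closure_pts_reg hV]

theorem exists_mem {x : X} {W : Set X} (hW : IsOpen W) (h : x ∈ W) :
    ∃ U ∈ boundedIdeal X, x ∈ U.pts ∧ closure U.pts ⊆ W := by
  obtain ⟨U, hU, h1, h2⟩ := exists_between isCompact_singleton hW (singleton_subset_iff.2 h)
  exact ⟨U, hU, singleton_subset_iff.1 h1, h2⟩

theorem isLocalContact : IsLocalContact (Contact (X := X)) (boundedIdeal X) where
  toIsContact := isContact
  bc1 U hU W h := by
    obtain ⟨V, hV, h1, h2⟩ := exists_between hU W.isOpen (nonTangential_iff.1 h)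
    exact ⟨V, hV, nonTangential_iff.2 h1, nonTangential_iff.2 h2⟩
  bc2 U V := by
    rintro ⟨x, hxU, hxV⟩
    obtain ⟨W, hW, h1, -⟩ := exists_mem isOpen_univ (mem_univ x)
    exact ⟨W, hW, x, hxU, W.isOpen.inter_closure ⟨h1, hxV⟩⟩
  bc3 U hU := by
    obtain ⟨x, hx⟩ := nonempty_pts.2 hU
    obtain ⟨V, hV, h1, h2⟩ := exists_mem U.isOpen hx
    exact ⟨V, hV, nonempty_pts.1 ⟨x, h1⟩, nonTangential_iff.2 h2⟩

end RegOpen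

open RegOpen

/-- The complete local contact algebra of regular open sets of a locally compact Hausdorff space. -/
noncomputable abbrev regOpenCLCA (X : Type u) [TopologicalSpace X] [T2Space X]
    [LocallyCompactSpace X] : CLCA.{u} where
  carrier := RegOpen X
  contact := Contact
  bounded := boundedIdeal X
  isLocalContact := isLocalContact

/-! ### The contravariant functor of regular open sets -/

section Preimage

variable {X Y : Type*} [TopologicalSpace X] [TopologicalSpace Y]

/-- Openness of `f` makes preimage commute with closure and interior, so no regularisation actually
takes place. -/
theorem pts_reg_preimage {f : X → Y} (hf : Continuous f) (ho : IsOpenMap f) (U : RegOpen Y) :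
    (reg (f ⁻¹' U.pts)).pts = f ⁻¹' U.pts := by
  rw [pts_reg, ← ho.preimage_closure_eq_closure_preimage hf,
    ← ho.preimage_interior_eq_interior_preimage hf, U.interior_closure]

theorem preimage_pts_reg {f : X → Y} (hf : Continuous f) (ho : IsOpenMap f) (s : Set Y) :
    f ⁻¹' (reg s).pts = (reg (f ⁻¹' s)).pts := by
  rw [pts_reg, pts_reg, ← ho.preimage_closure_eq_closure_preimage hf,
    ← ho.preimage_interior_eq_interior_preimage hf]

theorem reg_preimage_compl {f : X → Y} (hf : Continuous f) (ho : IsOpenMap f) (U : RegOpen Y) :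
    reg (f ⁻¹' (Uᶜ).pts) = (reg (f ⁻¹' U.pts))ᶜ := by
  apply pts_injective
  rw [pts_reg_preimage hf ho, pts_compl, pts_compl, pts_reg_preimage hf ho, preimage_compl,
    ho.preimage_closure_eq_closure_preimage hf]

/-- The preimage map on regular open sets along a continuous open map. -/
noncomputable def preimageHom (f : X → Y) (hf : Continuous f) (ho : IsOpenMap f) :
    CompleteLatticeHom (RegOpen Y) (RegOpen X) where
  toFun U := reg (f ⁻¹' U.pts)
  map_sSup' S := by
    apply pts_injective
    rw [pts_reg_preimage hf ho, pts_sSup, pts_sSup, preimage_pts_reg hf ho]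
    congr 2
    simp [pts_reg_preimage hf ho]
  map_sInf' S := by
    change reg (f ⁻¹' ((reg (⋃ U ∈ S, (Uᶜ).pts))ᶜ).pts) =
      (reg (⋃ U ∈ ((fun U : RegOpen Y => reg (f ⁻¹' U.pts)) '' S), (Uᶜ).pts))ᶜ
    rw [reg_preimage_compl hf ho]
    congr 1
    apply pts_injective
    rw [pts_reg_preimage hf ho, preimage_pts_reg hf ho]
    congr 2
    simp [← reg_preimage_compl hf ho, pts_reg_preimage hf ho]

theorem pts_preimageHom {f : X → Y} (hf : Continuous f) (ho : IsOpenMap f) (U : RegOpen Y) :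
    (preimageHom f hf ho U).pts = f ⁻¹' U.pts := pts_reg_preimage hf ho U

theorem closure_pts_preimageHom {f : X → Y} (hf : Continuous f) (ho : IsOpenMap f)
    (U : RegOpen Y) : closure (preimageHom f hf ho U).pts = f ⁻¹' closure U.pts := by
  rw [pts_preimageHom, ho.preimage_closure_eq_closure_preimage hf]

theorem preimageHom_comp {Z : Type*} [TopologicalSpace Z] {g : Y → Z} {f : X → Y}
    (hg : Continuous g) (hgo : IsOpenMap g) (hf : Continuous f) (hfo : IsOpenMap f)
    (U : RegOpen Z) : preimageHom (fun x => g (f x)) (hg.comp hf) (hgo.comp hfo) U =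
      preimageHom f hf hfo (preimageHom g hg hgo U) := by
  apply pts_injective
  rw [pts_preimageHom, pts_preimageHom, pts_preimageHom]
  rfl

theorem eq_of_preimageHom_eq [T2Space Y] [LocallyCompactSpace Y] {f g : X → Y}
    (hf : Continuous f) (hfo : IsOpenMap f) (hg : Continuous g) (hgo : IsOpenMap g)
    (h : preimageHom f hf hfo = preimageHom g hg hgo) : f = g := by
  funext y
  by_contra hne
  obtain ⟨W, W', hW, -, hx, hx', hd⟩ := t2_separation hne
  obtain ⟨U, -, hU, hUW⟩ := exists_mem hW hx
  have h2 : y ∈ f ⁻¹' U.pts := hU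
  rw [← pts_preimageHom hf hfo, h, pts_preimageHom] at h2
  exact disjoint_left.1 hd (hUW (subset_closure h2)) hx'

theorem IsPerfect.isProperMap {f : X → Y} (h : IsPerfect f) : IsProperMap f :=
  isProperMap_iff_isClosedMap_and_compact_fibers.2
    ⟨h.continuous, h.isClosedMap, fun {y} => h.isCompact_fiber y⟩

/-- The regularised image of `U` is a competitor in the infimum defining the left adjoint, and `f`
is closed. Both (L2) and (LO) come from this inclusion. -/
theorem closure_leftAdjoint_preimageHom_subset {f : X → Y} (hf : IsPerfect f)
    (ho : IsOpenMap f) (U : RegOpen X) :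
    closure (leftAdjoint (preimageHom f hf.continuous ho) U).pts ⊆ f '' closure U.pts := by
  have hc : IsClosed (f '' closure U.pts) := hf.isClosedMap _ isClosed_closure
  have h : leftAdjoint (preimageHom f hf.continuous ho) U ≤ reg (f '' U.pts) := by
    refine (leftAdjoint_gc _).l_le (le_iff.2 ?_)
    rw [pts_preimageHom, ← image_subset_iff]
    exact subset_reg (ho _ U.isOpen)
  refine (closure_mono (le_iff.1 h)).trans ?_
  rw [closure_pts_reg (ho _ U.isOpen), hc.closure_subset_iff]
  exact image_mono subset_closure

theorem contact_of_contact_preimageHom {f : X → Y} (hf : Continuous f) (ho : IsOpenMap f)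
    {U V : RegOpen Y} (h : Contact (preimageHom f hf ho U) (preimageHom f hf ho V)) :
    Contact U V := by
  obtain ⟨x, hx, hy⟩ := h
  rw [closure_pts_preimageHom] at hx hy
  exact ⟨f x, hx, hy⟩

theorem preimageHom_mem_boundedIdeal {f : X → Y} (hf : IsPerfect f) (ho : IsOpenMap f)
    {U : RegOpen Y} (hU : U ∈ boundedIdeal Y) :
    preimageHom f hf.continuous ho U ∈ boundedIdeal X := by
  rw [mem_boundedIdeal, closure_pts_preimageHom]
  exact hf.isProperMap.isCompact_preimage hU

theorem contact_preimageHom_of_contact_leftAdjoint {f : X → Y} (hf : IsPerfect f)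
    (ho : IsOpenMap f) {U : RegOpen X} {V : RegOpen Y}
    (h : Contact (leftAdjoint (preimageHom f hf.continuous ho) U) V) :
    Contact U (preimageHom f hf.continuous ho V) := by
  obtain ⟨y, hy, hyV⟩ := h
  obtain ⟨x, hx, rfl⟩ := closure_leftAdjoint_preimageHom_subset hf ho U hy
  refine ⟨x, hx, ?_⟩
  rw [closure_pts_preimageHom]
  exact hyV

end Preimage

/-- The morphism of complete local contact algebras induced by an open perfect map. -/
noncomputable def regOpenMap {X Y : OpPerLC.{u}} (f : OpPerLC.Hom X Y) :
    DOpPerLCHom (regOpenCLCA Y.carrier) (regOpenCLCA X.carrier) where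
  toHom := preimageHom f.toFun f.isPerfect.continuous f.isOpenMap
  l1 _ _ h := contact_of_contact_preimageHom f.isPerfect.continuous f.isOpenMap h
  l2 U hU := IsCompact.of_isClosed_subset (hU.image f.isPerfect.continuous) isClosed_closure
    (closure_leftAdjoint_preimageHom_subset f.isPerfect f.isOpenMap U)
  l3 _ hU := preimageHom_mem_boundedIdeal f.isPerfect f.isOpenMap hU
  lo _ _ _ h := contact_preimageHom_of_contact_leftAdjoint f.isPerfect f.isOpenMap h

theorem DOpPerLCHom.ext' {A B : CLCA.{u}} {φ ψ : DOpPerLCHom A B}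
    (h : ∀ a, φ.toHom a = ψ.toHom a) : φ = ψ :=
  DOpPerLCHom.ext (DFunLike.ext _ _ h)

/-- The functor sending a space to its algebra of regular open sets. -/
noncomputable def regOpenFunctor : OpPerLC.{u}ᵒᵖ ⥤ DOpPerLC.{u} where
  obj X := regOpenCLCA X.unop.carrier
  map f := regOpenMap f.unop
  map_id _ := DOpPerLCHom.ext' fun U => reg_pts U
  map_comp f g := DOpPerLCHom.ext' fun U =>
    preimageHom_comp f.unop.isPerfect.continuous f.unop.isOpenMap g.unop.isPerfect.continuous
      g.unop.isOpenMap U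

instance : (regOpenFunctor.{u}).Faithful where
  map_injective {X Y} f g h := by
    apply Quiver.Hom.unop_inj
    exact OpPerLC.Hom.ext (eq_of_preimageHom_eq f.unop.isPerfect.continuous f.unop.isOpenMap
      g.unop.isPerfect.continuous g.unop.isOpenMap
      (congrArg (fun φ : DOpPerLCHom _ _ => φ.toHom) h))

/-! ### Points of a local contact algebra -/

section Contact

variable {B : Type*} [BooleanAlgebra B] {ρ : B → B → Prop}

namespace IsContact

variable (h : IsContact ρ)
include h

theorem mono {a b c d : B} (hab : ρ a b) (hac : a ≤ c) (hbd : b ≤ d) : ρ c d := by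
  have h1 : ρ a d := by
    rw [← sup_eq_right.2 hbd]
    exact (h.sup_iff _ _ _).2 (.inl hab)
  have h2 : ρ d c := by
    rw [← sup_eq_right.2 hac]
    exact (h.sup_iff _ _ _).2 (.inl (h.symm _ _ h1))
  exact h.symm _ _ h2

theorem of_inf_ne_bot {a b : B} (hab : a ⊓ b ≠ ⊥) : ρ a b :=
  h.mono (h.refl_of_ne_bot _ hab) inf_le_left inf_le_right

theorem nonTangential_mono {a b c d : B} (hbc : NonTangential ρ b c) (hab : a ≤ b)
    (hcd : c ≤ d) : NonTangential ρ a d :=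
  fun H => hbc (h.mono H hab (compl_le_compl hcd))

theorem le_of_nonTangential {a b : B} (hab : NonTangential ρ a b) : a ≤ b := by
  by_contra H
  refine hab (h.of_inf_ne_bot fun h0 => H ?_)
  rwa [← disjoint_iff, disjoint_compl_right_iff] at h0

theorem nonTangential_inf {a b c : B} (hb : NonTangential ρ a b) (hc : NonTangential ρ a c) :
    NonTangential ρ a (b ⊓ c) := by
  intro H
  rw [compl_inf, h.sup_iff] at H
  exact H.elim hb hc

theorem nonTangential_inf_inf {a a' b c : B} (hb : NonTangential ρ a b)
    (hc : NonTangential ρ a' c) : NonTangential ρ (a ⊓ a') (b ⊓ c) :=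
  h.nonTangential_inf (h.nonTangential_mono hb inf_le_left le_rfl)
    (h.nonTangential_mono hc inf_le_right le_rfl)

theorem nonTangential_top (a : B) : NonTangential ρ a ⊤ := fun H =>
  (h.ne_bot _ _ H).2 compl_top

theorem nonTangential_compl {a b : B} (hab : NonTangential ρ a b) : NonTangential ρ bᶜ aᶜ := by
  intro H
  rw [compl_compl] at H
  exact hab (h.symm _ _ H)

end IsContact

/-- A point of a local contact algebra: a proper round filter with a bounded element which is
prime with respect to non-tangential inclusion. -/
structure IsPoint (ρ : B → B → Prop) (I : Order.Ideal B) (p : Set B) : Prop where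
  mono : ∀ a ∈ p, ∀ b, a ≤ b → b ∈ p
  inf : ∀ a ∈ p, ∀ b ∈ p, a ⊓ b ∈ p
  bot_notMem : ⊥ ∉ p
  exists_bounded : ∃ a ∈ p, a ∈ I
  round : ∀ a ∈ p, ∃ b ∈ p, NonTangential ρ b a
  prime : ∀ a b, NonTangential ρ a b → aᶜ ∈ p ∨ b ∈ p

variable {I : Order.Ideal B}

namespace IsPoint

variable {p : Set B} (hp : IsPoint ρ I p)
include hp

theorem compl_notMem {a : B} (ha : a ∈ p) : aᶜ ∉ p := fun h =>
  hp.bot_notMem (by simpa using hp.inf _ ha _ h)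

theorem top_mem : ⊤ ∈ p := by
  obtain ⟨a, ha, -⟩ := hp.exists_bounded
  exact hp.mono a ha _ le_top

theorem round_bounded (h : IsContact ρ) {a : B} (ha : a ∈ p) :
    ∃ b ∈ p, b ∈ I ∧ NonTangential ρ b a := by
  obtain ⟨b, hb, hba⟩ := hp.round a ha
  obtain ⟨c, hc, hcI⟩ := hp.exists_bounded
  exact ⟨b ⊓ c, hp.inf _ hb _ hc, I.lower inf_le_right hcI,
    h.nonTangential_mono hba inf_le_left le_rfl⟩

/-- Roundness of the larger point and primeness of the smaller make points an antichain; this is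
what separates points in the Hausdorff proof. -/
theorem eq_of_subset {q : Set B} (hq : IsPoint ρ I q) (hpq : p ⊆ q) :
    p = q := by
  refine hpq.antisymm fun a ha => ?_
  obtain ⟨b, hb, hba⟩ := hq.round a ha
  exact (hp.prime b a hba).resolve_left fun hn => hq.compl_notMem hb (hpq hn)

end IsPoint

/-- The round filter generated by a set `u`. -/
def roundFilter (ρ : B → B → Prop) (u : Set B) : Set B := {c | ∃ d ∈ u, NonTangential ρ d c}

/-- Primeness of `u` is required only across `≪`, so that the lemma covers both Boolean ultrafilters
and the trace of a topological ultrafilter on the basic sets. -/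
theorem IsLocalContact.isPoint_roundFilter (h : IsLocalContact ρ I) {u : Set B}
    (inf : ∀ a ∈ u, ∀ b ∈ u, a ⊓ b ∈ u) (bot : ⊥ ∉ u) (bdd : ∃ a ∈ u, a ∈ I)
    (prime : ∀ a b, NonTangential ρ a b → aᶜ ∈ u ∨ b ∈ u) :
    IsPoint ρ I (roundFilter ρ u) := by
  have hC := h.toIsContact
  have interp : ∀ c ∈ roundFilter ρ u, ∃ e ∈ I, e ∈ roundFilter ρ u ∧ NonTangential ρ e c := by
    rintro c ⟨d, hd, hdc⟩
    obtain ⟨k, hk, hkI⟩ := bdd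
    obtain ⟨e, he, h1, h2⟩ := h.bc1 (d ⊓ k) (I.lower inf_le_right hkI) c
      (hC.nonTangential_mono hdc inf_le_left le_rfl)
    exact ⟨e, he, ⟨_, inf _ hd _ hk, h1⟩, h2⟩
  have hinf : ∀ a ∈ roundFilter ρ u, ∀ b ∈ roundFilter ρ u, a ⊓ b ∈ roundFilter ρ u := by
    rintro a ⟨d, hd, hda⟩ b ⟨e, he, heb⟩
    exact ⟨_, inf _ hd _ he, hC.nonTangential_inf_inf hda heb⟩
  have hmono : ∀ a ∈ roundFilter ρ u, ∀ b, a ≤ b → b ∈ roundFilter ρ u := by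
    rintro a ⟨d, hd, hda⟩ b hab
    exact ⟨d, hd, hC.nonTangential_mono hda le_rfl hab⟩
  refine ⟨hmono, hinf, ?_, ?_, ?_, ?_⟩
  · rintro ⟨d, hd, h0⟩
    exact bot (by rwa [← le_bot_iff.1 (hC.le_of_nonTangential h0)])
  · obtain ⟨a, ha, -⟩ := bdd
    obtain ⟨e, he, h1, -⟩ := interp ⊤ ⟨a, ha, hC.nonTangential_top a⟩
    exact ⟨e, h1, he⟩
  · intro a ha
    obtain ⟨e, -, h1, h2⟩ := interp a ha
    exact ⟨e, h1, h2⟩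
  · intro a b hab
    -- (BC1) interpolates only above bounded elements, so `a` is first cut down by a bounded `e` in
    -- the filter. In `a ⊓ e ≪ g ≪ g' ≪ b`, primeness is applied to the middle pair and the outer
    -- two supply roundness.
    obtain ⟨k, hk, -⟩ := bdd
    obtain ⟨e, heI, he, -⟩ := interp ⊤ ⟨k, hk, hC.nonTangential_top k⟩
    obtain ⟨g, hgI, hg1, hg2⟩ := h.bc1 (a ⊓ e) (I.lower inf_le_right heI) b
      (hC.nonTangential_mono hab inf_le_left le_rfl)
    obtain ⟨g', -, hg3, hg4⟩ := h.bc1 g hgI b hg2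
    rcases prime g g' hg3 with hu | hu
    · left
      refine hmono _ (hinf _ ⟨_, hu, hC.nonTangential_compl hg1⟩ _ he) _ ?_
      rw [compl_inf, inf_sup_right, compl_inf_self, sup_bot_eq]
      exact inf_le_left
    · exact .inr ⟨g', hu, hg4⟩

/-- A prime filter separating an element from an ideal. -/
theorem exists_primeFilter {J : Order.Ideal B} {a : B} (ha : a ∉ J) :
    ∃ u : Set B, a ∈ u ∧ (∀ b ∈ u, b ∉ J) ∧ (∀ b ∈ u, ∀ c, b ≤ c → c ∈ u) ∧
      (∀ b ∈ u, ∀ c ∈ u, b ⊓ c ∈ u) ∧ ∀ b, b ∈ u ∨ bᶜ ∈ u := by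
  obtain ⟨P, hP, hJP, hd⟩ := DistribLattice.prime_ideal_of_disjoint_filter_ideal
    (F := Order.PFilter.principal a) (I := J) (by
      rw [Set.disjoint_left]
      exact fun b hb hbJ => ha (J.lower (Order.PFilter.mem_principal.1 hb) hbJ))
  refine ⟨(P : Set B)ᶜ, Set.disjoint_left.1 hd (Order.PFilter.mem_principal.2 le_rfl),
    fun b hb hbJ => hb (hJP hbJ), fun b hb c hbc hc => hb (P.lower hbc hc),
    fun b hb c hc hbc => (hP.mem_or_mem hbc).elim hb hc, fun b => ?_⟩
  by_contra! H
  have h1 : b ∈ P := not_not.1 H.1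
  have h2 : bᶜ ∈ P := not_not.1 H.2
  exact hP.toIsProper.top_notMem (by simpa using Order.Ideal.sup_mem h1 h2)

theorem IsContact.not_sup (h : IsContact ρ) {a b c : B} (hb : ¬ ρ a b) (hc : ¬ ρ a c) :
    ¬ ρ a (b ⊔ c) := fun H => ((h.sup_iff _ _ _).1 H).elim hb hc

/-- Ultrafilters `u` containing `k ⊓ a` and `v` containing `b` are built so that every member of `u`
is in contact with every member of `v`. The round filter of `u` is then a point: (BC2) supplies the
bounded `k`, and `bᶜ` is excluded because no member of `u` is out of contact with `b`. -/
theorem IsLocalContact.exists_isPoint_of_contact (h : IsLocalContact ρ I) {a b : B}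
    (hab : ρ a b) : ∃ p, IsPoint ρ I p ∧ aᶜ ∉ p ∧ bᶜ ∉ p := by
  have hC := h.toIsContact
  obtain ⟨k, hk, hka⟩ := h.bc2 b a (hC.symm _ _ hab)
  replace hka := hC.symm _ _ hka
  let J : Order.Ideal B :=
    { carrier := {c | ¬ ρ (k ⊓ a) c}
      lower' := fun c d hdc hc H => hc (hC.mono H le_rfl hdc)
      nonempty' := ⟨⊥, fun H => (hC.ne_bot _ _ H).2 rfl⟩
      directed' := fun c hc d hd => ⟨c ⊔ d, hC.not_sup hc hd, le_sup_left, le_sup_right⟩ }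
  obtain ⟨v, hbv, hvJ, vmono, vinf, -⟩ := exists_primeFilter (J := J) (a := b) (not_not.2 hka)
  let K : Order.Ideal B :=
    { carrier := {d | ∃ c ∈ v, ¬ ρ c d}
      lower' := fun c d hdc ⟨e, he, hec⟩ => ⟨e, he, fun H => hec (hC.mono H le_rfl hdc)⟩
      nonempty' := ⟨⊥, b, hbv, fun H => (hC.ne_bot _ _ H).2 rfl⟩
      directed' := by
        rintro c ⟨e, he, hec⟩ d ⟨e', he', hed⟩
        exact ⟨c ⊔ d, ⟨e ⊓ e', vinf _ he _ he', hC.not_sup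
          (fun H => hec (hC.mono H inf_le_left le_rfl))
          (fun H => hed (hC.mono H inf_le_right le_rfl))⟩, le_sup_left, le_sup_right⟩ }
  obtain ⟨u, hau, huK, umono, uinf, uprime⟩ := exists_primeFilter (J := K) (a := k ⊓ a) (by
    rintro ⟨c, hc, hca⟩
    exact hvJ c hc fun H => hca (hC.symm _ _ H))
  have hbot : ⊥ ∉ u := fun H => huK _ H K.bot_mem
  refine ⟨roundFilter ρ u, h.isPoint_roundFilter uinf hbot
    ⟨_, hau, I.lower inf_le_left hk⟩ (fun c d hcd => (uprime c).symm.imp id fun H =>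
      umono _ H _ (hC.le_of_nonTangential hcd)), ?_, ?_⟩
  · rintro ⟨d, hd, hda⟩
    have := uinf _ hau _ (umono _ hd _ (hC.le_of_nonTangential hda))
    rw [inf_assoc, inf_compl_self, inf_bot_eq] at this
    exact hbot this
  · rintro ⟨d, hd, hdb⟩
    rw [NonTangential, compl_compl] at hdb
    exact huK d hd ⟨b, hbv, fun H => hdb (hC.symm _ _ H)⟩

theorem IsLocalContact.exists_isPoint_mem (h : IsLocalContact ρ I) {a : B} (ha : a ≠ ⊥) :
    ∃ p, IsPoint ρ I p ∧ a ∈ p := by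
  obtain ⟨b, -, hb, hba⟩ := h.bc3 a ha
  obtain ⟨p, hp, hpb, -⟩ := h.exists_isPoint_of_contact (h.refl_of_ne_bot b hb)
  exact ⟨p, hp, (hp.prime b a hba).resolve_left hpb⟩

end Contact

theorem DOpPerLCHom.map_compl {A B : CLCA.{u}} (φ : DOpPerLCHom A B) (a : A.carrier) :
    φ.toHom aᶜ = (φ.toHom a)ᶜ := by
  refine (IsCompl.compl_eq ⟨?_, ?_⟩).symm
  · rw [disjoint_iff, ← map_inf, inf_compl_self, map_bot]
  · rw [codisjoint_iff, ← map_sup, sup_compl_eq_top, map_top]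

/-- (L1) gives primeness and (L2) a bounded member. For roundness, (LO) turns `d ≪ φ a` into `φ_Λ d
≪ a`, where (BC1) interpolates. -/
theorem DOpPerLCHom.isPoint_preimage {A B : CLCA.{u}} (φ : DOpPerLCHom A B) {p : Set B.carrier}
    (hp : IsPoint B.contact B.bounded p) :
    IsPoint A.contact A.bounded (φ.toHom ⁻¹' p) := by
  have hle := (leftAdjoint_gc φ.toHom).le_u_l
  refine ⟨fun a ha b hab => hp.mono _ ha _ (OrderHomClass.mono φ.toHom hab),
    fun a ha b hb => ?_, fun H => hp.bot_notMem ?_, ?_, fun a ha => ?_, fun a b hab => ?_⟩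
  · rw [mem_preimage, map_inf]
    exact hp.inf _ ha _ hb
  · rwa [mem_preimage, map_bot] at H
  · obtain ⟨b, hb, hbI⟩ := hp.exists_bounded
    exact ⟨_, hp.mono _ hb _ (hle b), φ.l2 b hbI⟩
  · obtain ⟨d, hd, hdI, hda⟩ := hp.round_bounded B.isLocalContact.toIsContact ha
    have h1 : NonTangential A.contact (leftAdjoint φ.toHom d) a := fun H =>
      hda (by rw [← φ.map_compl]; exact φ.lo _ _ hdI H)
    obtain ⟨b, -, hb1, hb2⟩ := A.isLocalContact.bc1 _ (φ.l2 d hdI) a h1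
    exact ⟨b, hp.mono _ hd _ ((leftAdjoint_gc φ.toHom).le_u
      (A.isLocalContact.toIsContact.le_of_nonTangential hb1)), hb2⟩
  · rw [mem_preimage, mem_preimage, φ.map_compl]
    refine hp.prime _ _ fun H => hab ?_
    rw [← φ.map_compl] at H
    exact φ.l1 _ _ H

/-! ### Fullness -/

section Full

variable {X Y : Type*} [TopologicalSpace X] [TopologicalSpace Y] [T2Space Y]
  [LocallyCompactSpace Y] {φ : CompleteLatticeHom (RegOpen Y) (RegOpen X)} {f : X → Y}

theorem continuous_of_pts_map_eq (h : ∀ U, (φ U).pts = f ⁻¹' U.pts) : Continuous f := by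
  rw [continuous_def]
  intro W hW
  rw [isOpen_iff_mem_nhds]
  intro x hx
  obtain ⟨U, -, hxU, hUW⟩ := exists_mem hW hx
  refine Filter.mem_of_superset ((φ U).isOpen.mem_nhds ?_)
    ((h U).subset.trans (preimage_mono (subset_closure.trans hUW)))
  rw [h]
  exact hxU

/-- A compact set lies in some bounded `U`, so its preimage is closed in the compact closure of `φ
U`. -/
theorem isPerfect_of_pts_map_eq (h : ∀ U, (φ U).pts = f ⁻¹' U.pts)
    (hb : ∀ U ∈ boundedIdeal Y, φ U ∈ boundedIdeal X) : IsPerfect f := by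
  have hf := continuous_of_pts_map_eq h
  have : IsProperMap f := by
    rw [isProperMap_iff_isCompact_preimage]
    refine ⟨hf, fun K hK => ?_⟩
    obtain ⟨U, hU, hKU, -⟩ := exists_between hK isOpen_univ (subset_univ K)
    refine (mem_boundedIdeal.1 (hb U hU)).of_isClosed_subset (hK.isClosed.preimage hf) ?_
    refine Subset.trans ?_ subset_closure
    rw [h]
    exact preimage_mono hKU
  exact ⟨hf, this.isClosedMap, fun y => this.isCompact_preimage isCompact_singleton⟩

variable [T2Space X] [LocallyCompactSpace X]

/-- The left adjoint of `φ` at `U` is an open set containing `f x`, and it lies in `f '' closure U`: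
a point off this compact image has a neighbourhood `V` with `U ≤ φ Vᶜ`, and adjunction expels the
point. -/
theorem isOpenMap_of_pts_map_eq (h : ∀ U, (φ U).pts = f ⁻¹' U.pts) : IsOpenMap f := by
  have hf := continuous_of_pts_map_eq h
  intro W hW
  rw [isOpen_iff_mem_nhds]
  rintro _ ⟨x, hx, rfl⟩
  obtain ⟨U, hU, hxU, hUW⟩ := exists_mem hW hx
  have hU' : U ≤ φ (leftAdjoint φ U) := (leftAdjoint_gc φ).le_u_l U
  have hx' : f x ∈ (leftAdjoint φ U).pts := by
    rw [← mem_preimage, ← h]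
    exact le_iff.1 hU' hxU
  refine Filter.mem_of_superset ((leftAdjoint φ U).isOpen.mem_nhds hx') fun y hy => ?_
  refine image_mono hUW ?_
  by_contra hn
  have hc : IsClosed (f '' closure U.pts) := (IsCompact.image hU hf).isClosed
  obtain ⟨V, -, hyV, hV⟩ := exists_mem hc.isOpen_compl hn
  have hle : U ≤ φ Vᶜ := by
    rw [le_iff, h, pts_compl]
    intro z hz hzV
    exact hV hzV (mem_image_of_mem f (subset_closure hz))
  have := le_iff.1 ((leftAdjoint_gc φ).l_le hle) hy
  rw [pts_compl] at this
  exact this (subset_closure hyV)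

theorem isPoint_nhds (x : X) :
    IsPoint (Contact (X := X)) (boundedIdeal X) {U : RegOpen X | x ∈ U.pts} where
  mono _ hU _ hUV := le_iff.1 hUV hU
  inf _ hU _ hV := ⟨hU, hV⟩
  bot_notMem h := h
  exists_bounded := by
    obtain ⟨U, hU, hx, -⟩ := exists_mem isOpen_univ (mem_univ x)
    exact ⟨U, hx, hU⟩
  round U hU := by
    obtain ⟨V, -, hx, hV⟩ := exists_mem U.isOpen hU
    exact ⟨V, hx, nonTangential_iff.2 hV⟩
  prime U V h := by
    rw [nonTangential_iff] at h
    rw [mem_ofPred_eq, pts_compl, mem_ofPred_eq, mem_compl_iff, ← imp_iff_not_or]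
    exact fun hx => h hx

/-- Compactness below a bounded member gives a common point of the closures; roundness puts it in
every member, and primeness puts each of its regular open neighbourhoods in `p`. -/
theorem exists_eq_nhds_of_isPoint {p : Set (RegOpen X)}
    (hp : IsPoint (Contact (X := X)) (boundedIdeal X) p) : ∃ x, ∀ U, U ∈ p ↔ x ∈ U.pts := by
  obtain ⟨K, hK, hKc⟩ := hp.exists_bounded
  have : Nonempty p := ⟨⟨K, hK⟩⟩
  have hne : (⋂ U : p, closure (K ⊓ U.1).pts).Nonempty := by
    refine IsCompact.nonempty_iInter_of_directed_nonempty_isCompact_isClosed _ ?_ ?_ ?_ ?_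
    · intro U V
      exact ⟨⟨U.1 ⊓ V.1, hp.inf _ U.2 _ V.2⟩,
        closure_mono (le_iff.1 (inf_le_inf_left _ inf_le_left)),
        closure_mono (le_iff.1 (inf_le_inf_left _ inf_le_right))⟩
    · intro U
      exact (nonempty_pts.2 fun h => hp.bot_notMem (h ▸ hp.inf _ hK _ U.2)).closure
    · exact fun U => hKc.of_isClosed_subset isClosed_closure
        (closure_mono (le_iff.1 inf_le_left))
    · exact fun _ => isClosed_closure
  obtain ⟨x, hx⟩ := hne
  have hmem : ∀ U ∈ p, x ∈ U.pts := by
    intro U hU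
    obtain ⟨V, hV, hVU⟩ := hp.round U hU
    exact nonTangential_iff.1 hVU
      (closure_mono (le_iff.1 inf_le_right) (mem_iInter.1 hx ⟨V, hV⟩))
  refine ⟨x, fun U => ⟨hmem U, fun hU => ?_⟩⟩
  obtain ⟨V, -, hxV, hVU⟩ := exists_mem U.isOpen hU
  refine (hp.prime V U (nonTangential_iff.2 hVU)).resolve_left fun hV => ?_
  have := hmem _ hV
  rw [pts_compl] at this
  exact this (subset_closure hxV)

end Full

theorem exists_map_of_DOpPerLCHom {X Y : OpPerLC.{u}}
    (φ : DOpPerLCHom (regOpenCLCA Y.carrier) (regOpenCLCA X.carrier)) :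
    ∃ f : X.carrier → Y.carrier, ∀ U, pts (φ.toHom U) = f ⁻¹' pts U := by
  choose f hf using fun x : X.carrier =>
    exists_eq_nhds_of_isPoint (φ.isPoint_preimage (isPoint_nhds x))
  exact ⟨f, fun U => Set.ext fun x => hf x U⟩

instance : (regOpenFunctor.{u}).Full where
  map_surjective {X Y} φ := by
    obtain ⟨f, hf⟩ := exists_map_of_DOpPerLCHom φ
    have hp := isPerfect_of_pts_map_eq hf φ.l3
    have ho := isOpenMap_of_pts_map_eq hf
    exact ⟨Quiver.Hom.op (⟨f, hp, ho⟩ : OpPerLC.Hom _ _), DOpPerLCHom.ext' fun U =>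
      pts_injective ((pts_preimageHom hp.continuous ho U).trans (hf U).symm)⟩

/-! ### The space of points -/

/-- The space of points of a complete local contact algebra. -/
def Pt (B : CLCA.{u}) : Type u := {p : Set B.carrier // IsPoint B.contact B.bounded p}

namespace Pt

variable {B : CLCA.{u}}

/-- The set of points containing a given element. -/
def basic (a : B.carrier) : Set (Pt B) := {p | a ∈ p.1}

instance : TopologicalSpace (Pt B) := generateFrom (range basic)

theorem basic_inf (a b : B.carrier) : basic (a ⊓ b) = basic a ∩ basic b := by
  ext p
  exact ⟨fun h => ⟨p.2.mono _ h _ inf_le_left, p.2.mono _ h _ inf_le_right⟩,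
    fun h => p.2.inf _ h.1 _ h.2⟩

theorem basic_mono {a b : B.carrier} (h : a ≤ b) : basic a ⊆ basic b :=
  fun p hp => p.2.mono _ hp _ h

theorem isTopologicalBasis : IsTopologicalBasis (range (basic (B := B))) where
  exists_subset_inter := by
    rintro _ ⟨a, rfl⟩ _ ⟨b, rfl⟩ p hp
    exact ⟨_, ⟨a ⊓ b, rfl⟩, by rwa [basic_inf], (basic_inf a b).subset⟩
  sUnion_eq := eq_univ_of_forall fun p => ⟨_, ⟨⊤, rfl⟩, p.2.top_mem⟩
  eq_generateFrom := rfl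

theorem isOpen_basic (a : B.carrier) : IsOpen (basic a) :=
  isTopologicalBasis.isOpen ⟨a, rfl⟩

theorem isContact (B : CLCA.{u}) : IsContact B.contact := B.isLocalContact.toIsContact

theorem nonempty_basic {a : B.carrier} : (basic a).Nonempty ↔ a ≠ ⊥ := by
  refine ⟨?_, fun h => ?_⟩
  · rintro ⟨p, hp⟩ rfl
    exact p.2.bot_notMem hp
  · obtain ⟨p, hp, ha⟩ := B.isLocalContact.exists_isPoint_mem h
    exact ⟨⟨p, hp⟩, ha⟩

theorem basic_subset_basic {a b : B.carrier} : basic a ⊆ basic b ↔ a ≤ b := by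
  refine ⟨fun h => ?_, basic_mono⟩
  by_contra hab
  have : a ⊓ bᶜ ≠ ⊥ := fun h0 => hab (disjoint_compl_right_iff.1 (disjoint_iff.2 h0))
  obtain ⟨p, hp⟩ := nonempty_basic.2 this
  rw [basic_inf] at hp
  exact p.2.compl_notMem (h hp.1) hp.2

/-- Every nonzero element lies in some point, so `basic c` misses `basic a` only if `c ≤ aᶜ`. -/
theorem mem_closure_basic {a : B.carrier} {p : Pt B} : p ∈ closure (basic a) ↔ aᶜ ∉ p.1 := by
  rw [isTopologicalBasis.mem_closure_iff]
  constructor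
  · intro h ha
    obtain ⟨q, hq, hqa⟩ := h _ ⟨aᶜ, rfl⟩ ha
    exact q.2.compl_notMem hqa hq
  · rintro h _ ⟨c, rfl⟩ hc
    rw [← basic_inf, nonempty_basic]
    exact fun h0 => h (p.2.mono c hc _ (le_compl_iff_disjoint_right.2 (disjoint_iff.2 h0)))

theorem closure_basic_compl (a : B.carrier) : closure (basic aᶜ) = (basic a)ᶜ := by
  ext p
  rw [mem_closure_basic, compl_compl]
  rfl

theorem closure_basic (a : B.carrier) : closure (basic a) = (basic aᶜ)ᶜ := by
  rw [← closure_basic_compl, compl_compl]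

theorem interior_closure_basic (a : B.carrier) : interior (closure (basic a)) = basic a := by
  rw [closure_basic, interior_compl, closure_basic_compl, compl_compl]

theorem closure_basic_subset {a b : B.carrier} (h : NonTangential B.contact a b) :
    closure (basic a) ⊆ basic b := fun p hp =>
  (p.2.prime a b h).resolve_left (mem_closure_basic.1 hp)

/-- The regular open set of points containing a given element. -/
def regBasic (a : B.carrier) : RegOpen (Pt B) := reg (basic a)

theorem pts_regBasic (a : B.carrier) : (regBasic a).pts = basic a := interior_closure_basic a

theorem regBasic_surjective : Function.Surjective (regBasic (B := B)) := by
  intro W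
  -- By regularity of `W` it suffices that `basic` of this join lies in `closure W.pts`. If a
  -- neighbourhood `basic c` missed `W`, then `cᶜ` would bound the joined family, so `cᶜ` would lie
  -- in the point along with `c`.
  refine ⟨sSup {b | basic b ⊆ W.pts}, le_antisymm (reg_le ?_) ?_⟩
  · refine Subset.trans (interior_maximal ?_ (isOpen_basic _)) W.interior_closure.subset
    intro p hp
    rw [isTopologicalBasis.mem_closure_iff]
    rintro _ ⟨c, rfl⟩ hc
    by_contra hn
    refine p.2.compl_notMem hc (p.2.mono _ hp _ (sSup_le fun b hb => ?_))
    rw [le_compl_iff_disjoint_right, disjoint_iff]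
    by_contra h0
    obtain ⟨q, hq⟩ := nonempty_basic.2 h0
    rw [basic_inf] at hq
    exact hn ⟨q, hq.2, hb hq.1⟩
  · rw [le_iff, pts_regBasic]
    intro p hp
    obtain ⟨_, ⟨b, rfl⟩, hb, hbW⟩ := isTopologicalBasis.exists_subset_of_mem_open hp W.isOpen
    exact p.2.mono b hb _ (le_sSup hbW)

variable (B) in
/-- A complete local contact algebra is isomorphic to the regular open algebra of its points. -/
noncomputable def orderIso : B.carrier ≃o RegOpen (Pt B) :=
  RelIso.ofSurjective
    (OrderEmbedding.ofMapLEIff regBasic fun a b => by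
      rw [le_iff, pts_regBasic, pts_regBasic, basic_subset_basic]) regBasic_surjective

theorem pts_orderIso (a : B.carrier) : (orderIso B a).pts = basic a := pts_regBasic a

theorem contact_iff {a b : B.carrier} :
    B.contact a b ↔ (closure (basic a) ∩ closure (basic b)).Nonempty := by
  constructor
  · intro h
    obtain ⟨p, hp, ha, hb⟩ := B.isLocalContact.exists_isPoint_of_contact h
    exact ⟨⟨p, hp⟩, mem_closure_basic.2 ha, mem_closure_basic.2 hb⟩
  · rintro ⟨p, ha, hb⟩
    rw [mem_closure_basic] at ha hb
    by_contra h
    exact (p.2.prime a bᶜ (by rwa [NonTangential, compl_compl])).elim ha hb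

/-- The elements `d` with `basic d ∈ F` generate a round filter, and this point is the limit of the
ultrafilter `F`. -/
theorem isCompact_closure_basic {a : B.carrier} (ha : a ∈ B.bounded) :
    IsCompact (closure (basic a)) := by
  have hC := isContact B
  rw [isCompact_iff_ultrafilter_le_nhds]
  intro F hF
  rw [Filter.le_principal_iff] at hF
  obtain ⟨k, hk, hak, -⟩ := B.isLocalContact.bc1 a ha ⊤ (hC.nonTangential_top a)
  have hp : IsPoint B.contact B.bounded (roundFilter B.contact {d | basic d ∈ F}) := by
    refine B.isLocalContact.isPoint_roundFilter (fun c hc d hd => ?_) (fun h => ?_)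
      ⟨k, Filter.mem_of_superset hF (closure_basic_subset hak), hk⟩ fun c d hcd => ?_
    · rw [mem_ofPred_eq, basic_inf]
      exact Filter.inter_mem hc hd
    · obtain ⟨p, hp⟩ := Filter.nonempty_of_mem (f := (F : Filter (Pt B))) h
      exact p.2.bot_notMem hp
    -- The complement of `basic d` is `closure (basic dᶜ)`, and `dᶜ ≪ cᶜ` places it inside `basic
    -- cᶜ`.
    · rcases F.mem_or_compl_mem (basic d) with h | h
      · exact .inr h
      · rw [← closure_basic_compl] at h
        exact .inl (Filter.mem_of_superset h (closure_basic_subset (hC.nonTangential_compl hcd)))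
  let x : Pt B := ⟨_, hp⟩
  refine ⟨x, ?_, ?_⟩
  · rw [mem_closure_basic]
    rintro ⟨d, hd, hda⟩
    refine F.empty_notMem ?_
    refine Filter.mem_of_superset (Filter.inter_mem hd hF) ?_
    rintro p ⟨hpd, hpa⟩
    exact mem_closure_basic.1 hpa (p.2.mono d hpd _ (hC.le_of_nonTangential hda))
  · rw [isTopologicalBasis.nhds_hasBasis.ge_iff]
    rintro _ ⟨⟨c, rfl⟩, d, hd, hdc⟩
    exact Filter.mem_of_superset hd (basic_mono (hC.le_of_nonTangential hdc))

/-- Conversely to the previous lemma, every point has a bounded member, so the bounded basic sets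
form a directed open cover and a compact closure lies inside one of them. -/
theorem mem_bounded_iff {a : B.carrier} : a ∈ B.bounded ↔ IsCompact (closure (basic a)) := by
  refine ⟨isCompact_closure_basic, fun h => ?_⟩
  have : Nonempty B.bounded := ⟨⟨⊥, B.bounded.bot_mem⟩⟩
  obtain ⟨b, hb⟩ := h.elim_directed_cover (fun b : B.bounded => basic b.1)
    (fun b => isOpen_basic _)
    (fun p _ => by
      obtain ⟨b, hb, hbI⟩ := p.2.exists_bounded
      exact mem_iUnion.2 ⟨⟨b, hbI⟩, hb⟩)
    (fun b c => ⟨⟨b.1 ⊔ c.1, Order.Ideal.sup_mem b.2 c.2⟩, basic_mono le_sup_left,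
      basic_mono le_sup_right⟩)
  exact B.bounded.lower (basic_subset_basic.1 (subset_closure.trans hb)) b.2

instance : T2Space (Pt B) where
  t2 p q hpq := by
    obtain ⟨c, hc, hcq⟩ : ∃ c ∈ p.1, c ∉ q.1 := by
      by_contra! H
      exact hpq (Subtype.ext (p.2.eq_of_subset q.2 H))
    obtain ⟨d, hd, hdc⟩ := p.2.round c hc
    refine ⟨basic d, basic dᶜ, isOpen_basic _, isOpen_basic _, hd,
      (q.2.prime d c hdc).resolve_right hcq, ?_⟩
    rw [disjoint_left]
    exact fun r h1 h2 => r.2.compl_notMem h1 h2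

instance : WeaklyLocallyCompactSpace (Pt B) where
  exists_compact_mem_nhds p := by
    obtain ⟨b, hb, hbI⟩ := p.2.exists_bounded
    exact ⟨_, isCompact_closure_basic hbI,
      Filter.mem_of_superset ((isOpen_basic b).mem_nhds hb) subset_closure⟩

end Pt

/-! ### Isomorphisms of complete local contact algebras -/

theorem leftAdjoint_orderIso {A B : Type*} [CompleteLattice A] [CompleteLattice B]
    (e : A ≃o B) (b : B) :
    leftAdjoint (CompleteLatticeHom.OrderIso.toCompleteLatticeHom e) b = e.symm b :=
  (leftAdjoint_gc (CompleteLatticeHom.OrderIso.toCompleteLatticeHom e)).l_unique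
    e.symm.to_galoisConnection fun _ => rfl

/-- An order isomorphism respecting contact and boundedness, as a morphism. -/
def DOpPerLCHom.ofOrderIso {A B : CLCA.{u}} (e : A.carrier ≃o B.carrier)
    (hc : ∀ a b, A.contact a b ↔ B.contact (e a) (e b))
    (hb : ∀ a, a ∈ A.bounded ↔ e a ∈ B.bounded) : DOpPerLCHom A B where
  toHom := CompleteLatticeHom.OrderIso.toCompleteLatticeHom e
  l1 a b h := (hc a b).2 h
  l2 b h := by
    rw [leftAdjoint_orderIso, hb, e.apply_symm_apply]
    exact h
  l3 a h := (hb a).1 h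
  lo a b _ h := by
    rw [leftAdjoint_orderIso, hc, e.apply_symm_apply] at h
    exact h

/-- An order isomorphism respecting contact and boundedness, as an isomorphism of `DOpPerLC`. -/
def DOpPerLC.isoOfOrderIso {A B : CLCA.{u}} (e : A.carrier ≃o B.carrier)
    (hc : ∀ a b, A.contact a b ↔ B.contact (e a) (e b))
    (hb : ∀ a, a ∈ A.bounded ↔ e a ∈ B.bounded) :
    Iso (C := DOpPerLC.{u}) A B where
  hom := DOpPerLCHom.ofOrderIso e hc hb
  inv := DOpPerLCHom.ofOrderIso e.symm (fun a b => by simp [hc]) (fun a => by simp [hb])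
  hom_inv_id := DOpPerLCHom.ext' e.symm_apply_apply
  inv_hom_id := DOpPerLCHom.ext' e.apply_symm_apply

/-! ### Essential surjectivity and the equivalence. -/

instance : (regOpenFunctor.{u}).EssSurj where
  mem_essImage (B : CLCA) := by
    refine ⟨Opposite.op ⟨Pt B⟩, ⟨(DOpPerLC.isoOfOrderIso (A := B) (B := regOpenCLCA (Pt B))
      (Pt.orderIso B) (fun a b => ?_) (fun a => ?_)).symm⟩⟩
    · rw [Pt.contact_iff, ← Pt.pts_orderIso, ← Pt.pts_orderIso]
      rfl
    · rw [Pt.mem_bounded_iff, ← Pt.pts_orderIso]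
      rfl

instance : (regOpenFunctor.{u}).IsEquivalence where

end LocalContact

theorem theorem2p21 :
    Nonempty (LocalContact.OpPerLC.{u}ᵒᵖ ≌ LocalContact.DOpPerLC.{u}) :=
  ⟨LocalContact.regOpenFunctor.asEquivalence⟩
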